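/- An integer rectangle is a rectangle $[x_1,x_2]\times[y_1,y_2]\subset\mathbb{R}^2$ with $x_1,x_2,y_1,y_2\in\mathbb{Z}$, $x_1<x_2$ and $y_1<y_2$; its height is $y_2-y_1$ and its width is $x_2-x_1$. Let $S$ be a finite family of integer rectangles with pairwise disjoint interiors. Two distinct rectangles $A,B$ of $S$ see each other if some vertical or horizontal line segment intersects the interiors of both $A$ and $B$ and intersects no other (closed) rectangle of $S$. The family $S$ is a rectangle visibility representation of a graph $G$ if its rectangles correspond to the vertices of $G$ and two distinct vertices are adjacent in $G$ if and only if their rectangles see each other. The bounding box of $S$ is the smallest rectangle with horizontal and vertical sides that contains all rectangles of $S$. The height of $G$, denoted $\operatorname{height}(G)$, is the minimum height of the bounding box of $S$, over all rectangle visibility representations $S$ of $G$ by integer rectangles whose bounding box has height less than or equal to its width. **Theorem.** The complete graph $K_7$ has a rectangle visibility representation, and $\operatorname{height}(K_7)=7$. -/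

import Mathlib

/-- An integer rectangle: sides horizontal and vertical, corners lattice points, positive width and
height. -/
@[ext]
structure IntRect where
  x₁ : ℤ
  x₂ : ℤ
  y₁ : ℤ
  y₂ : ℤ
  hx : x₁ < x₂
  hy : y₁ < y₂

namespace IntRect

/-- The closed rectangle `[x₁, x₂] × [y₁, y₂]` in the plane. -/
def toSet (A : IntRect) : Set (ℝ × ℝ) :=
  Set.Icc (A.x₁ : ℝ) (A.x₂ : ℝ) ×ˢ Set.Icc (A.y₁ : ℝ) (A.y₂ : ℝ)

/-- The horizontal extent (number of columns). -/
def width (A : IntRect) : ℤ := A.x₂ - A.x₁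

/-- The vertical extent (number of rows). -/
def height (A : IntRect) : ℤ := A.y₂ - A.y₁

end IntRect

/-- `L` is a vertical or a horizontal line segment in the plane. -/
def IsAxisSegment (L : Set (ℝ × ℝ)) : Prop :=
  (∃ c a b : ℝ, a ≤ b ∧ L = {c} ×ˢ Set.Icc a b) ∨
    (∃ c a b : ℝ, a ≤ b ∧ L = Set.Icc a b ×ˢ {c})

/-- In the family `S`, the rectangles `S i` and `S j` see each other: some vertical or horizontal
segment meets the interiors of both and meets no other closed rectangle of the family. -/
def Sees {V : Type*} (S : V → IntRect) (i j : V) : Prop :=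
  ∃ L : Set (ℝ × ℝ), IsAxisSegment L ∧
    (L ∩ interior (S i).toSet).Nonempty ∧ (L ∩ interior (S j).toSet).Nonempty ∧
    ∀ k, k ≠ i → k ≠ j → Disjoint L (S k).toSet

/-- `S` is a rectangle visibility representation of the graph `G`, the rectangle of the vertex `v`
being `S v`: the interiors are pairwise disjoint (touching boundaries are allowed), and distinct
vertices are adjacent exactly when their rectangles see each other. -/
structure IsRVRepresentation {V : Type*} (G : SimpleGraph V) (S : V → IntRect) : Prop where
  disjoint : ∀ i j, i ≠ j → Disjoint (interior (S i).toSet) (interior (S j).toSet)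
  adj_iff : ∀ i j, i ≠ j → (G.Adj i j ↔ Sees S i j)

/-- `R` is the bounding box of the family `S`: the smallest rectangle containing all of it. -/
def IsBoundingBox {V : Type*} (S : V → IntRect) (R : IntRect) : Prop :=
  (∀ i, (S i).toSet ⊆ R.toSet) ∧
    ∀ R' : IntRect, (∀ i, (S i).toSet ⊆ R'.toSet) → R.toSet ⊆ R'.toSet

/-- The heights of the bounding boxes, with height at most width, of the rectangle visibility
representations of `G`. -/
def representationHeights {V : Type*} (G : SimpleGraph V) : Set ℤ :=
  {h | ∃ (S : V → IntRect) (R : IntRect), IsRVRepresentation G S ∧ IsBoundingBox S R ∧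
    R.height ≤ R.width ∧ R.height = h}

/-- `height(G) = h`: the minimum height of the bounding box over all rectangle visibility
representations of `G` whose bounding box has height at most its width exists and equals `h`. -/
def HasHeight {V : Type*} (G : SimpleGraph V) (h : ℤ) : Prop :=
  IsLeast (representationHeights G) h

/-! The upper bound is the explicit family `sevenRects`. For the lower bound, note that in a
representation of a complete graph two rectangles share a row exactly when they are separated
horizontally, and then they see each other along a row; otherwise one lies above the other and they
see each other along a column.

Number the rectangles from left to right and keep only their row intervals, as bit masks. A
representation of height at most six becomes a sequence satisfying `IsAdmissible`
(`exists_isAdmissible`): once some rectangle lies to the right of a given one, so do all later ones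
(`persists`), and each of them sees it along an unobstructed row (`visible`). Of the columns only
one consequence is kept (`indep`): no five rectangles are stacked, since five bars would realise the
nonplanar graph $K_5$ (`not_stacked`). The condition `canonical` breaks ties in the numbering and
shortens the search. There are 21 possible masks, and a finite search excludes seven terms
(`not_isAdmissible_seven`). -/

/-! ### An exhaustive search over sequences of row intervals

The rows of a strip of height six are the bits `0, …, 5` of a natural number. The auxiliary functions
are written with recursors and force their numerical arguments, so that the kernel evaluates the
search quickly. -/

/-- The nonempty intervals of rows in a strip with six rows. -/
def rowMasks : List ℕ :=
  [1, 3, 7, 15, 31, 63, 2, 6, 14, 30, 62, 4, 12, 28, 60, 8, 24, 56, 16, 48, 32]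

/-- The rows of `r` that are not rows of `m`. -/
def removeRows (r m : ℕ) : ℕ := Nat.xor r (Nat.land r m)

/-- Application, with evaluation of the argument. -/
def applyForced (f : ℕ → Bool) (n : ℕ) : Bool := Nat.rec (f 0) (fun k _ => f (k + 1)) n

/-- `m` shares a row with every member of `l`. -/
def meetsAll (m : ℕ) (l : List ℕ) : Bool :=
  List.rec true (fun r _ ih => Nat.rec false (fun _ _ => ih) (Nat.land m r)) l

/-- `m` shares a row with some member of `l`. -/
def meetsSome (m : ℕ) (l : List ℕ) : Bool :=
  List.rec false (fun r _ ih => Nat.rec ih (fun _ _ => true) (Nat.land m r)) l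

/-- Conjunction of `f` over a list. -/
def allOf (f : ℕ → Bool) (l : List ℕ) : Bool :=
  List.rec true (fun r _ ih => Bool.rec false ih (f r)) l

/-- Prepend to `act` the masks of `l` with the rows of `m` removed, then apply `f`. -/
def withRemoved (m : ℕ) (f : List ℕ → Bool) (l : List ℕ) : List ℕ → Bool :=
  List.rec (fun act => f act)
    (fun r _ ih act => applyForced (fun s => ih (s :: act)) (removeRows r m)) l

/-- Move the masks of `l` that meet `m` to `act`, with the rows of `m` removed, and the others to
`un`, then apply `f`. -/
def withSplit (m : ℕ) (f : List ℕ → List ℕ → Bool) (l : List ℕ) : List ℕ → List ℕ → Bool :=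
  List.rec (fun act un => f act un)
    (fun r _ ih act un => Nat.rec (ih act (r :: un))
      (fun _ _ => applyForced (fun s => ih (s :: act) un) (removeRows r m)) (Nat.land m r)) l

/-- No admissible sequence has `n` further masks. The list `act` holds the rows of earlier masks which
are still visible from the right, for those that share a row with a later one; `un` holds the other
earlier masks; `last` is the previous mask. -/
def refutes (n : ℕ) : List ℕ → List ℕ → ℕ → Bool :=
  Nat.rec (fun _ _ _ => false)
    -- The members of `un` are pairwise disjoint, so five of them end the branch. A new mask must
    -- meet every member of `act`, because those rectangles have to see all later ones.
    (fun _ ih act un last => Nat.ble 5 un.length || allOf (fun m =>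
      !meetsAll m act || !(Nat.ble last m || meetsSome m un) ||
        withRemoved m (fun act' => withSplit m (fun a u => ih a (m :: u) m) un act' []) act [])
      rowMasks) n

theorem refutes_seven : refutes 7 [] [] 0 = true := by decide +kernel

/-! ### Specifications of the search functions -/

theorem applyForced_eq (f : ℕ → Bool) (n : ℕ) : applyForced f n = f n := by
  cases n <;> rfl

theorem meetsAll_eq_true {m : ℕ} {l : List ℕ} (h : ∀ r ∈ l, m &&& r ≠ 0) :
    meetsAll m l = true := by
  induction l with
  | nil => rfl
  | cons r l ih =>
    obtain ⟨k, hk⟩ := Nat.exists_eq_succ_of_ne_zero (h r (by simp))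
    have : meetsAll m (r :: l) =
        Nat.rec false (fun _ _ => meetsAll m l) (m &&& r) := rfl
    rw [this, hk]
    exact ih fun s hs => h s (by simp [hs])

theorem meetsSome_eq_true {m : ℕ} {l : List ℕ} {r : ℕ} (hr : r ∈ l) (h : m &&& r ≠ 0) :
    meetsSome m l = true := by
  induction l with
  | nil => simp at hr
  | cons s l ih =>
    have e : meetsSome m (s :: l) =
        Nat.rec (meetsSome m l) (fun _ _ => true) (m &&& s) := rfl
    rw [e]
    rcases Nat.eq_zero_or_eq_succ_pred (m &&& s) with h0 | h0
    · rw [h0]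
      refine ih ?_
      rcases List.mem_cons.1 hr with rfl | h1
      · exact absurd h0 h
      · exact h1
    · rw [h0]

theorem allOf_eq_true {f : ℕ → Bool} {l : List ℕ} (h : allOf f l = true) {r : ℕ} (hr : r ∈ l) :
    f r = true := by
  induction l with
  | nil => simp at hr
  | cons s l ih =>
    have e : allOf f (s :: l) = Bool.rec false (allOf f l) (f s) := rfl
    rw [e] at h
    cases hs : f s with
    | false => rw [hs] at h; cases h
    | true =>
      rw [hs] at h
      rcases List.mem_cons.1 hr with rfl | h1
      · exact hs
      · exact ih h h1

theorem withRemoved_eq (m : ℕ) (f : List ℕ → Bool) (l act : List ℕ) :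
    withRemoved m f l act = f ((l.map (removeRows · m)).reverse ++ act) := by
  induction l generalizing act with
  | nil => rfl
  | cons r l ih =>
    have e : withRemoved m f (r :: l) act =
        applyForced (fun s => withRemoved m f l (s :: act)) (removeRows r m) := rfl
    rw [e, applyForced_eq, ih]
    simp

theorem withSplit_eq (m : ℕ) (f : List ℕ → List ℕ → Bool) (l act un : List ℕ) :
    withSplit m f l act un =
      f (((l.filter (m &&& · ≠ 0)).map (removeRows · m)).reverse ++ act)
        ((l.filter (m &&& · = 0)).reverse ++ un) := by
  induction l generalizing act un with
  | nil => rfl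
  | cons r l ih =>
    have e : withSplit m f (r :: l) act un = Nat.rec (withSplit m f l act (r :: un))
        (fun _ _ => applyForced (fun s => withSplit m f l (s :: act) un) (removeRows r m))
        (m &&& r) := rfl
    rw [e]
    rcases Nat.eq_zero_or_eq_succ_pred (m &&& r) with h0 | h0
    · rw [h0]
      change withSplit m f l act (r :: un) = _
      rw [ih]
      simp [h0]
    · have h1 : m &&& r ≠ 0 := by omega
      rw [h0]
      change applyForced (fun s => withSplit m f l (s :: act) un) (removeRows r m) = _
      rw [applyForced_eq, ih]
      simp [h1]

theorem refutes_succ {n : ℕ} {act un : List ℕ} {last m : ℕ}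
    (h : refutes (n + 1) act un last = true) (hun : un.length < 5) (hm : m ∈ rowMasks)
    (hact : ∀ r ∈ act, m &&& r ≠ 0) (hlast : last ≤ m ∨ ∃ r ∈ un, m &&& r ≠ 0) :
    refutes n (((un.filter (m &&& · ≠ 0)).map (removeRows · m)).reverse ++
      (act.map (removeRows · m)).reverse) (m :: (un.filter (m &&& · = 0)).reverse) m = true := by
  have e : refutes (n + 1) act un last = (Nat.ble 5 un.length || allOf (fun m =>
      !meetsAll m act || !(Nat.ble last m || meetsSome m un) ||
        withRemoved m (fun act' => withSplit m (fun a u => refutes n a (m :: u) m) un act' [])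
          act []) rowMasks) := rfl
  rw [e, Bool.or_eq_true] at h
  rcases h with h | h
  · have := Nat.le_of_ble_eq_true h
    omega
  have h1 := allOf_eq_true h hm
  have h2 : (Nat.ble last m || meetsSome m un) = true := by
    rcases hlast with h3 | ⟨r, hr, h3⟩
    · simp [Nat.ble_eq_true_of_le h3]
    · simp [meetsSome_eq_true hr h3]
  simp only [meetsAll_eq_true hact, h2, withRemoved_eq, withSplit_eq] at h1
  simpa using h1

/-! ### Bits of masks and the invariant of the search -/

theorem testBit_removeRows (r m t : ℕ) :
    (removeRows r m).testBit t = (r.testBit t && !m.testBit t) := by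
  change (r ^^^ (r &&& m)).testBit t = _
  rw [Nat.testBit_xor, Nat.testBit_and]
  cases r.testBit t <;> cases m.testBit t <;> rfl

theorem land_ne_zero_iff_exists_testBit {a b : ℕ} :
    a &&& b ≠ 0 ↔ ∃ t, a.testBit t = true ∧ b.testBit t = true := by
  constructor
  · intro h
    obtain ⟨t, ht⟩ := Nat.exists_testBit_of_ne_zero h
    exact ⟨t, by simpa using ht⟩
  · rintro ⟨t, h1, h2⟩ h
    have := congrArg (Nat.testBit · t) h
    simp [h1, h2] at this

/-- A sequence of row intervals in which sharing a row persists to the right and every shared row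
pair is visible, in a canonical order, and without five pairwise disjoint members. -/
structure IsAdmissible (N : ℕ) (m : ℕ → ℕ) : Prop where
  mem : ∀ i < N, m i ∈ rowMasks
  persists : ∀ i j k, i < j → j < k → k < N → m i &&& m j ≠ 0 → m i &&& m k ≠ 0
  visible : ∀ i j, i < j → j < N → m i &&& m j ≠ 0 → ∃ t, (m i).testBit t = true ∧
    (m j).testBit t = true ∧ ∀ k, i < k → k < j → (m k).testBit t = false
  canonical : ∀ j, j + 1 < N → m j ≤ m (j + 1) ∨
    ∃ i ≤ j, m i &&& m (j + 1) ≠ 0 ∧ ∀ k, i < k → k ≤ j → m i &&& m k = 0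
  indep : ∀ f : Fin 5 → ℕ, (∀ a, f a < N) → ¬ ∀ a b, a ≠ b → m (f a) &&& m (f b) = 0

/-- The state of the search after the first `p` masks. -/
structure IsSearchState (m : ℕ → ℕ) (p : ℕ) (act un : List ℕ) : Prop where
  act_spec : ∀ r ∈ act, ∃ i j, i < j ∧ j < p ∧ m i &&& m j ≠ 0 ∧
    ∀ t, r.testBit t = true ↔
      (m i).testBit t = true ∧ ∀ k, i < k → k < p → (m k).testBit t = false
  un_spec : ∀ r ∈ un, ∃ i < p, m i = r ∧ ∀ k, i < k → k < p → m i &&& m k = 0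
  mem_un : ∀ i < p, (∀ k, i < k → k < p → m i &&& m k = 0) → m i ∈ un
  pairwise : un.Pairwise fun a b => a &&& b = 0

namespace IsSearchState

variable {m : ℕ → ℕ} {p : ℕ} {act un : List ℕ}

theorem step (h : IsSearchState m p act un) :
    IsSearchState m (p + 1)
      (((un.filter (m p &&& · ≠ 0)).map (removeRows · (m p))).reverse ++
        (act.map (removeRows · (m p))).reverse)
      (m p :: (un.filter (m p &&& · = 0)).reverse) where
  act_spec := by
    intro s hs
    simp only [List.mem_append, List.mem_reverse, List.mem_map, List.mem_filter,
      decide_eq_true_eq] at hs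
    rcases hs with ⟨r, ⟨hr, hne⟩, rfl⟩ | ⟨r, hr, rfl⟩
    · obtain ⟨i, hi, rfl, hk⟩ := h.un_spec r hr
      refine ⟨i, p, hi, by omega, by rwa [Nat.land_comm], fun t => ?_⟩
      rw [testBit_removeRows]
      constructor
      · intro ht
        simp only [Bool.and_eq_true, Bool.not_eq_true'] at ht
        refine ⟨ht.1, fun k hik hkp => ?_⟩
        rcases Nat.lt_succ_iff_lt_or_eq.1 hkp with h1 | rfl
        · by_contra h2
          -- No mask between `i` and `p` meets `m i`, so all its rows were still visible before `p`.
          exact land_ne_zero_iff_exists_testBit.2 ⟨t, ht.1, by simpa using h2⟩ (hk k hik h1)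
        · exact ht.2
      · rintro ⟨h1, h2⟩
        simp [h1, h2 p hi (by omega)]
    · obtain ⟨i, j, hij, hj, hne, hr⟩ := h.act_spec r hr
      refine ⟨i, j, hij, by omega, hne, fun t => ?_⟩
      rw [testBit_removeRows]
      simp only [Bool.and_eq_true, Bool.not_eq_true', hr]
      constructor
      · rintro ⟨⟨h1, h2⟩, h3⟩
        refine ⟨h1, fun k hik hkp => ?_⟩
        rcases Nat.lt_succ_iff_lt_or_eq.1 hkp with h4 | rfl
        · exact h2 k hik h4
        · exact h3
      · rintro ⟨h1, h2⟩
        exact ⟨⟨h1, fun k hik hk => h2 k hik (by omega)⟩, h2 p (by omega) (by omega)⟩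
  un_spec := by
    intro r hr
    simp only [List.mem_cons, List.mem_reverse, List.mem_filter, decide_eq_true_eq] at hr
    rcases hr with rfl | ⟨hr, h0⟩
    · exact ⟨p, by omega, rfl, fun k h1 h2 => by omega⟩
    · obtain ⟨i, hi, rfl, hk⟩ := h.un_spec r hr
      refine ⟨i, by omega, rfl, fun k hik hkp => ?_⟩
      rcases Nat.lt_succ_iff_lt_or_eq.1 hkp with h4 | rfl
      · exact hk k hik h4
      · rwa [Nat.land_comm]
  mem_un := by
    intro i hi hk
    simp only [List.mem_cons, List.mem_reverse, List.mem_filter, decide_eq_true_eq]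
    rcases Nat.lt_succ_iff_lt_or_eq.1 hi with h4 | rfl
    · exact Or.inr ⟨h.mem_un i h4 fun k h1 h2 => hk k h1 (by omega),
        by rw [Nat.land_comm]; exact hk p h4 (by omega)⟩
    · exact Or.inl rfl
  pairwise := by
    rw [List.pairwise_cons]
    constructor
    · intro r hr
      simp only [List.mem_reverse, List.mem_filter, decide_eq_true_eq] at hr
      exact hr.2
    · rw [List.pairwise_reverse]
      exact (h.pairwise.filter _).imp fun {a b} hab => by rwa [Nat.land_comm]

theorem refutes_step {N n last : ℕ} (hm : IsAdmissible N m) (hp : p < N)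
    (h : IsSearchState m p act un) (hlast : ∀ q, p = q + 1 → last = m q) (h0 : p = 0 → last = 0)
    (hr : refutes (n + 1) act un last = true) :
    ∃ act' un', IsSearchState m (p + 1) act' un' ∧ refutes n act' un' (m p) = true := by
  refine ⟨_, _, h.step, refutes_succ hr ?_ (hm.mem p hp) ?_ ?_⟩
  -- Five members of `un` would be five pairwise disjoint masks, against `indep`.
  · by_contra hlen
    have hget : ∀ a : Fin 5, ∃ i < p, m i = un[(a : ℕ)]'(by omega) := fun a => by
      obtain ⟨i, hi, h1, -⟩ := h.un_spec _ (List.getElem_mem (l := un) (n := a) (by omega))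
      exact ⟨i, hi, h1⟩
    choose f hf hfe using hget
    refine hm.indep f (fun a => (hf a).trans hp) fun a b hab => ?_
    rw [hfe, hfe]
    have hp := List.pairwise_iff_getElem.1 h.pairwise
    rcases lt_or_gt_of_ne hab with h1 | h1
    · exact hp _ _ _ _ h1
    · rw [Nat.land_comm]
      exact hp _ _ _ _ h1
  · intro r hr
    obtain ⟨i, j, hij, hj, hne, hr⟩ := h.act_spec r hr
    -- By persistence `m i` also meets `m p`; the row in which they see each other has not been
    -- removed from `r`.
    obtain ⟨t, h1, h2, h3⟩ := hm.visible i p (by omega) hp (hm.persists i j p hij hj hp hne)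
    exact land_ne_zero_iff_exists_testBit.2 ⟨t, h2, (hr t).2 ⟨h1, h3⟩⟩
  · rcases p with _ | q
    · exact Or.inl (by omega)
    · rw [hlast q rfl]
      rcases hm.canonical q hp with h1 | ⟨i, hi, h1, h2⟩
      · exact Or.inl h1
      · exact Or.inr ⟨m i, h.mem_un i (by omega) fun k h3 h4 => h2 k h3 (by omega),
          by rwa [Nat.land_comm]⟩

end IsSearchState

theorem not_isAdmissible_seven (m : ℕ → ℕ) : ¬ IsAdmissible 7 m := by
  intro hm
  have key : ∀ p ≤ 7, ∃ act un last, IsSearchState m p act un ∧ (∀ q, p = q + 1 → last = m q) ∧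
      (p = 0 → last = 0) ∧ refutes (7 - p) act un last = true := by
    intro p
    induction p with
    | zero =>
      exact fun _ => ⟨[], [], 0, ⟨by simp, by simp, by simp, by simp⟩, by simp, by simp,
        refutes_seven⟩
    | succ p ih =>
      intro hp
      obtain ⟨act, un, last, hs, h1, h2, h3⟩ := ih (by omega)
      rw [show 7 - p = 7 - (p + 1) + 1 by omega] at h3
      obtain ⟨act', un', hs', h4⟩ := hs.refutes_step hm (by omega) h1 h2 h3
      exact ⟨act', un', m p, hs', by intro q hq; congr; omega, by omega, h4⟩
  obtain ⟨act, un, last, -, -, -, h⟩ := key 7 le_rfl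
  -- With no masks left to place, `refutes 0` is `false` on every state.
  exact Bool.false_ne_true h

/-! ### Visibility in terms of rows and columns -/

namespace IntRect

theorem interior_toSet (A : IntRect) :
    interior A.toSet = Set.Ioo (A.x₁ : ℝ) A.x₂ ×ˢ Set.Ioo (A.y₁ : ℝ) A.y₂ := by
  rw [toSet, interior_prod_eq, interior_Icc, interior_Icc]

theorem toSet_subset_iff {A B : IntRect} :
    A.toSet ⊆ B.toSet ↔ (B.x₁ ≤ A.x₁ ∧ A.x₂ ≤ B.x₂) ∧ B.y₁ ≤ A.y₁ ∧ A.y₂ ≤ B.y₂ := by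
  have hx : (A.x₁ : ℝ) ≤ A.x₂ := by exact_mod_cast A.hx.le
  have hy : (A.y₁ : ℝ) ≤ A.y₂ := by exact_mod_cast A.hy.le
  have hne : (A.toSet).Nonempty := ⟨(A.x₁, A.y₁), ⟨le_rfl, hx⟩, ⟨le_rfl, hy⟩⟩
  rw [toSet, toSet, Set.prod_subset_prod_iff]
  simp only [Set.Icc_eq_empty_iff, hx, hy, Set.Icc_subset_Icc_iff hx,
    Set.Icc_subset_Icc_iff hy, Int.cast_le, not_true, or_false]

theorem disjoint_interior_iff {A B : IntRect} :
    Disjoint (interior A.toSet) (interior B.toSet) ↔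
      (A.x₂ ≤ B.x₁ ∨ B.x₂ ≤ A.x₁) ∨ A.y₂ ≤ B.y₁ ∨ B.y₂ ≤ A.y₁ := by
  have hA := A.hx
  have hA' := A.hy
  have hB := B.hx
  have hB' := B.hy
  simp only [interior_toSet, Set.disjoint_prod, Set.Ioo_disjoint_Ioo, ← Int.cast_min,
    ← Int.cast_max, Int.cast_le]
  omega

/-- Reflection in the diagonal. -/
def swap (A : IntRect) : IntRect := ⟨A.y₁, A.y₂, A.x₁, A.x₂, A.hy, A.hx⟩

/-- The rectangle `A` occupies the row between the heights `t` and `t + 1`. -/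
def HasRow (A : IntRect) (t : ℤ) : Prop := A.y₁ ≤ t ∧ t < A.y₂

end IntRect

section Config

variable {V W : Type*}

/-- In some row, both `S i` and `S j` occur and no other rectangle separates them. -/
def RowSees (S : V → IntRect) (i j : V) : Prop :=
  ∃ t : ℤ, (S i).HasRow t ∧ (S j).HasRow t ∧ ∀ k, k ≠ i → k ≠ j → (S k).HasRow t →
    ¬ ((S i).x₂ ≤ (S k).x₁ ∧ (S k).x₂ ≤ (S j).x₁) ∧ ¬ ((S j).x₂ ≤ (S k).x₁ ∧ (S k).x₂ ≤ (S i).x₁)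

theorem not_between_of_disjoint {a b p q : ℝ} {u₂ v₁ w₁ w₂ : ℤ} (hp : p ∈ Set.Icc a b)
    (hq : q ∈ Set.Icc a b) (hpu : p < u₂) (hvq : v₁ < q) (hw : w₁ < w₂)
    (hd : Disjoint (Set.Icc a b) (Set.Icc (w₁ : ℝ) w₂)) : ¬ (u₂ ≤ w₁ ∧ w₂ ≤ v₁) := by
  rintro ⟨h1, h2⟩
  have h1 : (u₂ : ℝ) ≤ w₁ := by exact_mod_cast h1
  have h2 : (w₂ : ℝ) ≤ v₁ := by exact_mod_cast h2
  have hw : (w₁ : ℝ) < w₂ := by exact_mod_cast hw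
  exact Set.disjoint_left.1 hd
    (show (w₁ : ℝ) ∈ Set.Icc a b from ⟨by linarith [hp.1], by linarith [hq.2]⟩) ⟨le_rfl, hw.le⟩

theorem floor_mem_of_mem_Ioo {c : ℝ} {a b : ℤ} (h : c ∈ Set.Ioo (a : ℝ) b) :
    a ≤ ⌊c⌋ ∧ ⌊c⌋ < b :=
  ⟨Int.le_floor.2 h.1.le, Int.floor_lt.2 h.2⟩

theorem mem_Icc_of_floor_mem {c : ℝ} {a b : ℤ} (h1 : a ≤ ⌊c⌋) (h2 : ⌊c⌋ < b) :
    c ∈ Set.Icc (a : ℝ) b :=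
  ⟨Int.le_floor.1 h1, (Int.floor_lt.1 h2).le⟩

/-- A segment at coordinate `c` is moved to the row or column `⌊c⌋`. This also works for integral
`c`: interiors containing `c` occupy that row, and a closed rectangle occupying it contains the
coordinate `c`, so it may not lie between. -/
theorem Sees.rowSees_or_rowSees_swap {S : V → IntRect} {i j : V} (h : Sees S i j) :
    RowSees S i j ∨ RowSees (fun k => (S k).swap) i j := by
  obtain ⟨L, ⟨c, a, b, -, rfl⟩ | ⟨c, a, b, -, rfl⟩, ⟨p, hpL, hp⟩, ⟨q, hqL, hq⟩, hk⟩ := h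
  all_goals
    rw [IntRect.interior_toSet] at hp hq
    obtain ⟨hp1, hp2⟩ := hp
    obtain ⟨hq1, hq2⟩ := hq
    obtain ⟨hpc, hp3⟩ := hpL
    obtain ⟨hqc, hq3⟩ := hqL
  · right
    rw [Set.mem_singleton_iff.1 hpc] at hp1
    rw [Set.mem_singleton_iff.1 hqc] at hq1
    refine ⟨⌊c⌋, floor_mem_of_mem_Ioo hp1, floor_mem_of_mem_Ioo hq1, fun k hki hkj hkt => ?_⟩
    have hd := (Set.disjoint_prod.1 (hk k hki hkj)).resolve_left fun h =>
      Set.disjoint_left.1 h (Set.mem_singleton c) (mem_Icc_of_floor_mem hkt.1 hkt.2)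
    exact ⟨not_between_of_disjoint hp3 hq3 hp2.2 hq2.1 (S k).hy hd,
      not_between_of_disjoint hq3 hp3 hq2.2 hp2.1 (S k).hy hd⟩
  · left
    rw [Set.mem_singleton_iff.1 hp3] at hp2
    rw [Set.mem_singleton_iff.1 hq3] at hq2
    refine ⟨⌊c⌋, floor_mem_of_mem_Ioo hp2, floor_mem_of_mem_Ioo hq2, fun k hki hkj hkt => ?_⟩
    have hd := (Set.disjoint_prod.1 (hk k hki hkj)).resolve_right fun h =>
      Set.disjoint_left.1 h (Set.mem_singleton c) (mem_Icc_of_floor_mem hkt.1 hkt.2)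
    exact ⟨not_between_of_disjoint hpc hqc hp1.2 hq1.1 (S k).hx hd,
      not_between_of_disjoint hqc hpc hq1.2 hp1.1 (S k).hx hd⟩

/-- Pairwise interior-disjoint rectangles any two of which see each other along a row or a column. -/
structure IsMutuallyVisible (S : V → IntRect) : Prop where
  disjoint : ∀ i j, i ≠ j → ((S i).x₂ ≤ (S j).x₁ ∨ (S j).x₂ ≤ (S i).x₁) ∨
    (S i).y₂ ≤ (S j).y₁ ∨ (S j).y₂ ≤ (S i).y₁
  sees : ∀ i j, i ≠ j → RowSees S i j ∨ RowSees (fun k => (S k).swap) i j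

theorem RowSees.comp {S : V → IntRect} {f : W → V} (hf : Function.Injective f) {i j : W}
    (h : RowSees S (f i) (f j)) : RowSees (fun k => S (f k)) i j := by
  obtain ⟨t, h1, h2, h3⟩ := h
  exact ⟨t, h1, h2, fun k hi hj => h3 (f k) (hf.ne hi) (hf.ne hj)⟩

namespace IsMutuallyVisible

variable {S : V → IntRect}

theorem comp (h : IsMutuallyVisible S) {f : W → V} (hf : Function.Injective f) :
    IsMutuallyVisible fun k => S (f k) where
  disjoint _ _ hij := h.disjoint _ _ (hf.ne hij)
  sees _ _ hij := (h.sees _ _ (hf.ne hij)).imp (fun h => h.comp hf)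
    fun h => RowSees.comp (S := fun k => (S k).swap) hf h

/-- Rectangles that are separated horizontally see each other along a row. -/
theorem rowSees (h : IsMutuallyVisible S) {i j : V} (hij : (S i).x₂ ≤ (S j).x₁) :
    RowSees S i j := by
  have hi := (S i).hx
  have hj := (S j).hx
  have hne : i ≠ j := by
    rintro rfl
    omega
  -- Sight along a column needs a common column, which horizontal separation excludes.
  refine (h.sees i j hne).resolve_right ?_
  rintro ⟨t, h1, h2, -⟩
  simp only [IntRect.HasRow, IntRect.swap] at h1 h2
  omega

/-- Rectangles that are separated vertically see each other along a column. -/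
theorem rowSees_swap (h : IsMutuallyVisible S) {i j : V} (hij : (S i).y₂ ≤ (S j).y₁) :
    RowSees (fun k => (S k).swap) i j := by
  have hi := (S i).hy
  have hj := (S j).hy
  have hne : i ≠ j := by
    rintro rfl
    omega
  refine (h.sees i j hne).resolve_left ?_
  rintro ⟨t, h1, h2, -⟩
  simp only [IntRect.HasRow] at h1 h2
  omega

theorem separated_of_hasRow (h : IsMutuallyVisible S) {i j : V} (hij : i ≠ j) {t : ℤ}
    (hi : (S i).HasRow t) (hj : (S j).HasRow t) :
    (S i).x₂ ≤ (S j).x₁ ∨ (S j).x₂ ≤ (S i).x₁ := by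
  refine (h.disjoint i j hij).resolve_right ?_
  simp only [IntRect.HasRow] at hi hj
  omega

/-- There are no five rectangles that are pairwise vertically separated: the complete graph on five
vertices is not a bar visibility graph. -/
theorem not_stacked {S : Fin 5 → IntRect} (h : IsMutuallyVisible S)
    (hS : ∀ i j, i ≠ j → (S i).y₂ ≤ (S j).y₁ ∨ (S j).y₂ ≤ (S i).y₁) : False := by
  let σ := Tuple.sort fun i => (S i).y₁
  have hmono : Monotone fun i => (S (σ i)).y₁ := Tuple.monotone_sort fun i => (S i).y₁
  have hT := h.comp σ.injective
  have hlt : ∀ i j, i < j → (S (σ i)).y₂ ≤ (S (σ j)).y₁ := fun i j hij => by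
    have h1 : (S (σ i)).y₁ ≤ (S (σ j)).y₁ := hmono hij.le
    have h2 := (S (σ j)).hy
    have h3 := hS _ _ (σ.injective.ne hij.ne)
    omega
  have hsee : ∀ i j, i < j → ∃ c, ((S (σ i)).x₁ ≤ c ∧ c < (S (σ i)).x₂) ∧
      ((S (σ j)).x₁ ≤ c ∧ c < (S (σ j)).x₂) ∧
      ∀ k, i < k → k < j → c < (S (σ k)).x₁ ∨ (S (σ k)).x₂ ≤ c := fun i j hij => by
    obtain ⟨c, h1, h2, h3⟩ := hT.rowSees_swap (hlt i j hij)
    refine ⟨c, h1, h2, fun k hik hkj => ?_⟩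
    by_contra h4
    exact (h3 k hik.ne' hkj.ne ⟨by simp only [IntRect.swap]; omega,
      by simp only [IntRect.swap]; omega⟩).1 ⟨hlt i k hik, hlt k j hkj⟩
  -- Bars 1, 2, 3 overlap consecutively, so all lie on one side of `c04`. By `c13`, bars 1 and 3
  -- both protrude beyond bar 2 at one end; `c02` and `c24` make bar 2 protrude beyond both at the
  -- other. Then `c03` needs bar 3 to protrude beyond bar 1 at the first end, and `c14` needs the
  -- reverse.
  obtain ⟨c01, a01, b01, -⟩ := hsee 0 1 (by decide)
  obtain ⟨c12, a12, b12, -⟩ := hsee 1 2 (by decide)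
  obtain ⟨c23, a23, b23, -⟩ := hsee 2 3 (by decide)
  obtain ⟨c34, a34, b34, -⟩ := hsee 3 4 (by decide)
  obtain ⟨c02, a02, b02, d02⟩ := hsee 0 2 (by decide)
  obtain ⟨c13, a13, b13, d13⟩ := hsee 1 3 (by decide)
  obtain ⟨c24, a24, b24, d24⟩ := hsee 2 4 (by decide)
  obtain ⟨c03, a03, b03, d03⟩ := hsee 0 3 (by decide)
  obtain ⟨c14, a14, b14, d14⟩ := hsee 1 4 (by decide)
  obtain ⟨c04, a04, b04, d04⟩ := hsee 0 4 (by decide)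
  have e02 := d02 1 (by decide) (by decide)
  have e13 := d13 2 (by decide) (by decide)
  have e24 := d24 3 (by decide) (by decide)
  have e03 := d03 1 (by decide) (by decide)
  have e03' := d03 2 (by decide) (by decide)
  have e14 := d14 2 (by decide) (by decide)
  have e14' := d14 3 (by decide) (by decide)
  have e04 := d04 1 (by decide) (by decide)
  have e04' := d04 2 (by decide) (by decide)
  have e04'' := d04 3 (by decide) (by decide)
  clear d02 d13 d24 d03 d14 d04 hsee hlt hT hmono h hS
  omega

end IsMutuallyVisible

end Config

theorem IsRVRepresentation.isMutuallyVisible {V : Type*} {S : V → IntRect}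
    (h : IsRVRepresentation (SimpleGraph.completeGraph V) S) : IsMutuallyVisible S where
  disjoint i j hij := IntRect.disjoint_interior_iff.1 (h.disjoint i j hij)
  sees i j hij := ((h.adj_iff i j hij).1 hij).rowSees_or_rowSees_swap

/-! ### A representation of the complete graph on seven vertices in seven rows -/

theorem Sees.symm {V : Type*} {S : V → IntRect} {i j : V} (h : Sees S i j) : Sees S j i := by
  obtain ⟨L, h1, h2, h3, h4⟩ := h
  exact ⟨L, h1, h3, h2, fun k hj hi => h4 k hi hj⟩

/-- A row in which nothing meets the gap between `S i` and `S j`. -/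
def IsFreeRow {V : Type*} (S : V → IntRect) (i j : V) (t : ℤ) : Prop :=
  ((S i).y₁ ≤ t ∧ t < (S i).y₂) ∧ ((S j).y₁ ≤ t ∧ t < (S j).y₂) ∧ (S i).x₂ ≤ (S j).x₁ ∧
    ∀ k, k ≠ i → k ≠ j →
      (S k).y₂ ≤ t ∨ t < (S k).y₁ ∨ (S k).x₂ < (S i).x₂ ∨ (S j).x₁ < (S k).x₁

instance {n : ℕ} (S : Fin n → IntRect) (i j : Fin n) (t : ℤ) : Decidable (IsFreeRow S i j t) := by
  unfold IsFreeRow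
  infer_instance

theorem half_mem_Ioo {a b t : ℤ} (h : a ≤ t ∧ t < b) : (t + 1 / 2 : ℝ) ∈ Set.Ioo (a : ℝ) b := by
  have h1 : (a : ℝ) ≤ t := by exact_mod_cast h.1
  have h2 : (t + 1 : ℝ) ≤ b := by exact_mod_cast h.2
  constructor <;> linarith

theorem disjoint_singleton_half {a b t : ℤ} (h : b ≤ t ∨ t < a) :
    Disjoint ({(t + 1 / 2 : ℝ)} : Set ℝ) (Set.Icc (a : ℝ) b) := by
  rw [Set.disjoint_singleton_left]
  rintro ⟨h1, h2⟩
  rcases h with h | h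
  · have : (b : ℝ) ≤ t := by exact_mod_cast h
    linarith
  · have : (t + 1 : ℝ) ≤ a := by exact_mod_cast h
    linarith

/-- The segment enters each of the two rectangles by half a unit, so integer sides strictly beyond
the gap miss it. -/
theorem disjoint_gap {u₂ v₁ w₁ w₂ : ℤ} (h : w₂ < u₂ ∨ v₁ < w₁) :
    Disjoint (Set.Icc (u₂ - 1 / 2 : ℝ) (v₁ + 1 / 2)) (Set.Icc (w₁ : ℝ) w₂) := by
  rw [Set.disjoint_left]
  rintro z ⟨h1, h2⟩ ⟨h3, h4⟩
  rcases h with h | h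
  · have : (w₂ + 1 : ℝ) ≤ u₂ := by exact_mod_cast h
    linarith
  · have : (v₁ + 1 : ℝ) ≤ w₁ := by exact_mod_cast h
    linarith

theorem gap_endpoints {u₁ u₂ v₁ v₂ : ℤ} (hu : u₁ < u₂) (hv : v₁ < v₂) (h : u₂ ≤ v₁) :
    (u₂ - 1 / 2 : ℝ) ≤ v₁ + 1 / 2 ∧ (u₂ - 1 / 2 : ℝ) ∈ Set.Ioo (u₁ : ℝ) u₂ ∧
      (v₁ + 1 / 2 : ℝ) ∈ Set.Ioo (v₁ : ℝ) v₂ := by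
  have h1 : (u₁ + 1 : ℝ) ≤ u₂ := by exact_mod_cast hu
  have h2 : (v₁ + 1 : ℝ) ≤ v₂ := by exact_mod_cast hv
  have h3 : (u₂ : ℝ) ≤ v₁ := by exact_mod_cast h
  refine ⟨?_, ⟨?_, ?_⟩, ?_, ?_⟩ <;> linarith

theorem IsFreeRow.sees {V : Type*} {S : V → IntRect} {i j : V} {t : ℤ} (h : IsFreeRow S i j t) :
    Sees S i j := by
  obtain ⟨h1, h2, h3, h4⟩ := h
  obtain ⟨hle, hi, hj⟩ := gap_endpoints (S i).hx (S j).hx h3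
  refine ⟨_, Or.inr ⟨t + 1 / 2, _, _, hle, rfl⟩,
    ⟨(_, _), ⟨⟨le_rfl, hle⟩, rfl⟩, ?_⟩, ⟨(_, _), ⟨⟨hle, le_rfl⟩, rfl⟩, ?_⟩, fun k hki hkj => ?_⟩
  · rw [IntRect.interior_toSet]
    exact ⟨hi, half_mem_Ioo h1⟩
  · rw [IntRect.interior_toSet]
    exact ⟨hj, half_mem_Ioo h2⟩
  · have h5 := h4 k hki hkj
    rw [← or_assoc] at h5
    exact Set.disjoint_prod.2 (h5.symm.imp disjoint_gap disjoint_singleton_half)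

theorem IsFreeRow.sees_of_swap {V : Type*} {S : V → IntRect} {i j : V} {t : ℤ}
    (h : IsFreeRow (fun k => (S k).swap) i j t) : Sees S i j := by
  obtain ⟨h1, h2, h3, h4⟩ := h
  obtain ⟨hle, hi, hj⟩ := gap_endpoints (S i).hy (S j).hy h3
  refine ⟨_, Or.inl ⟨t + 1 / 2, _, _, hle, rfl⟩,
    ⟨(_, _), ⟨rfl, ⟨le_rfl, hle⟩⟩, ?_⟩, ⟨(_, _), ⟨rfl, ⟨hle, le_rfl⟩⟩, ?_⟩, fun k hki hkj => ?_⟩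
  · rw [IntRect.interior_toSet]
    exact ⟨half_mem_Ioo h1, hi⟩
  · rw [IntRect.interior_toSet]
    exact ⟨half_mem_Ioo h2, hj⟩
  · have h5 := h4 k hki hkj
    rw [← or_assoc] at h5
    exact Set.disjoint_prod.2 (h5.imp disjoint_singleton_half disjoint_gap)

/-- Seven mutually visible rectangles in a box of width eight and height seven. -/
def sevenRects : Fin 7 → IntRect :=
  ![⟨0, 7, 0, 1, by decide, by decide⟩, ⟨0, 1, 1, 5, by decide, by decide⟩,
    ⟨0, 8, 6, 7, by decide, by decide⟩, ⟨2, 5, 1, 2, by decide, by decide⟩,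
    ⟨1, 3, 4, 6, by decide, by decide⟩, ⟨4, 6, 3, 5, by decide, by decide⟩,
    ⟨7, 8, 0, 6, by decide, by decide⟩]

/-- `Fin 8` covers the seven rows and the eight columns. Both orders of the pair are tried because
`IsFreeRow` is directed. -/
theorem sevenRects_free : ∀ i j : Fin 7, i ≠ j → ∃ t : Fin 8,
    (IsFreeRow sevenRects i j t ∨ IsFreeRow sevenRects j i t) ∨
      IsFreeRow (fun k => (sevenRects k).swap) i j t ∨
      IsFreeRow (fun k => (sevenRects k).swap) j i t := by
  decide +kernel

theorem sevenRects_disjoint : ∀ i j : Fin 7, i ≠ j →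
    ((sevenRects i).x₂ ≤ (sevenRects j).x₁ ∨ (sevenRects j).x₂ ≤ (sevenRects i).x₁) ∨
      (sevenRects i).y₂ ≤ (sevenRects j).y₁ ∨ (sevenRects j).y₂ ≤ (sevenRects i).y₁ := by
  decide +kernel

theorem isRVRepresentation_sevenRects :
    IsRVRepresentation (SimpleGraph.completeGraph (Fin 7)) sevenRects where
  disjoint i j hij := IntRect.disjoint_interior_iff.2 (sevenRects_disjoint i j hij)
  adj_iff i j hij := by
    refine iff_of_true hij ?_
    obtain ⟨t, (h | h) | h | h⟩ := sevenRects_free i j hij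
    · exact h.sees
    · exact h.sees.symm
    · exact h.sees_of_swap
    · exact h.sees_of_swap.symm

theorem isBoundingBox_sevenRects :
    IsBoundingBox sevenRects ⟨0, 8, 0, 7, by decide, by decide⟩ := by
  constructor
  · intro i
    rw [IntRect.toSet_subset_iff]
    revert i
    decide +kernel
  · intro R hR
    -- Rectangle 0 contains the lower left corner of the box and rectangle 2 the upper right one.
    have h0 := IntRect.toSet_subset_iff.1 (hR 0)
    have h2 := IntRect.toSet_subset_iff.1 (hR 2)
    rw [IntRect.toSet_subset_iff]
    exact ⟨⟨h0.1.1, h2.1.2⟩, h0.2.1, h2.2.2⟩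

theorem seven_mem_representationHeights :
    7 ∈ representationHeights (SimpleGraph.completeGraph (Fin 7)) :=
  ⟨_, _, isRVRepresentation_sevenRects, isBoundingBox_sevenRects, by decide, rfl⟩

/-! ### The lower bound -/

namespace IntRect

/-- The rows of `A`, counted from the height `Y`, as the bits of a natural number. -/
def rowMask (Y : ℤ) (A : IntRect) : ℕ :=
  (2 ^ (A.y₂ - A.y₁).toNat - 1) <<< (A.y₁ - Y).toNat

variable {Y : ℤ} {A B : IntRect}

theorem testBit_rowMask (hA : Y ≤ A.y₁) (t : ℕ) :
    (A.rowMask Y).testBit t = true ↔ A.HasRow (Y + t) := by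
  have h := A.hy
  rw [rowMask, Nat.testBit_shiftLeft, Nat.testBit_two_pow_sub_one, HasRow]
  simp only [Bool.and_eq_true, decide_eq_true_eq]
  omega

theorem rowMask_land_ne_zero_iff (hA : Y ≤ A.y₁) (hB : Y ≤ B.y₁) :
    A.rowMask Y &&& B.rowMask Y ≠ 0 ↔ ∃ t, A.HasRow t ∧ B.HasRow t := by
  rw [land_ne_zero_iff_exists_testBit]
  simp only [testBit_rowMask hA, testBit_rowMask hB]
  constructor
  · rintro ⟨t, h⟩
    exact ⟨_, h⟩
  · rintro ⟨t, h⟩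
    refine ⟨(t - Y).toNat, ?_⟩
    have h1 := h.1.1
    rwa [show Y + ((t - Y).toNat : ℤ) = t by omega]

theorem rowMask_mem (hA : Y ≤ A.y₁) (hA' : A.y₂ ≤ Y + 6) : A.rowMask Y ∈ rowMasks := by
  have key : ∀ a d : Fin 7, 0 < d.val → a.val + d.val ≤ 6 →
      (2 ^ d.val - 1) <<< a.val ∈ rowMasks := by decide
  have h := A.hy
  exact key ⟨(A.y₁ - Y).toNat, by omega⟩ ⟨(A.y₂ - A.y₁).toNat, by omega⟩ (by simp only; omega)
    (by simp only; omega)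

/-- A power of two at the separating height lies between the masks. Thus the bottom-to-top order of
ties becomes the numerical comparison in `canonical`. -/
theorem rowMask_le_of_y₂_le (hA : Y ≤ A.y₁) (h : A.y₂ ≤ B.y₁) : A.rowMask Y ≤ B.rowMask Y := by
  have h1 := A.hy
  have h2 := B.hy
  have h3 : A.rowMask Y ≤ 2 ^ (A.y₂ - Y).toNat := by
    rw [rowMask, Nat.shiftLeft_eq, show (A.y₂ - Y).toNat = (A.y₂ - A.y₁).toNat + (A.y₁ - Y).toNat
      by omega, pow_add]
    exact Nat.mul_le_mul_right _ (Nat.sub_le _ _)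
  have h4 : 2 ^ (B.y₁ - Y).toNat ≤ B.rowMask Y := by
    rw [rowMask, Nat.shiftLeft_eq]
    refine Nat.le_mul_of_pos_left _ (Nat.sub_pos_of_lt ?_)
    exact Nat.one_lt_two_pow (by omega)
  exact h3.trans ((Nat.pow_le_pow_right (by norm_num) (by omega)).trans h4)

end IntRect

/-! ### Numbering the rectangles from left to right -/

section LeftOf

variable {V : Type*} [Fintype V] (S : V → IntRect)

/-- The rectangles to the left of `S i`. -/
def leftOf (i : V) : Finset V := {j | (S j).x₂ ≤ (S i).x₁}

variable {S} {i j k : V}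

@[simp] theorem mem_leftOf : j ∈ leftOf S i ↔ (S j).x₂ ≤ (S i).x₁ := by simp [leftOf]

/-- The sets `leftOf S i` form a chain, growing with `(S i).x₁`, so cardinality decides inclusion.
-/
theorem leftOf_subset_of_card_le (h : (leftOf S i).card ≤ (leftOf S j).card) :
    leftOf S i ⊆ leftOf S j := by
  have mono : ∀ a b : V, (S a).x₁ ≤ (S b).x₁ → leftOf S a ⊆ leftOf S b := fun a b hab c hc => by
    rw [mem_leftOf] at hc ⊢
    exact hc.trans hab
  rcases le_total (S i).x₁ (S j).x₁ with h1 | h1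
  · exact mono i j h1
  · exact (Finset.eq_of_subset_of_card_le (mono j i h1) h).ge

theorem card_leftOf_lt (h : (S i).x₂ ≤ (S j).x₁) : (leftOf S i).card < (leftOf S j).card := by
  by_contra h1
  have h2 := leftOf_subset_of_card_le (not_lt.1 h1) (mem_leftOf.2 h)
  rw [mem_leftOf] at h2
  exact absurd (S i).hx (not_lt.2 h2)

end LeftOf

namespace IsMutuallyVisible

/-- The rectangles can be numbered from left to right, those with the same rectangles to the left
from bottom to top. -/
theorem exists_order {n : ℕ} {S : Fin n → IntRect} (h : IsMutuallyVisible S) :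
    ∃ σ : Equiv.Perm (Fin n),
      (∀ i j, (S (σ i)).x₂ ≤ (S (σ j)).x₁ → i < j) ∧
      (∀ i j k, (S (σ i)).x₂ ≤ (S (σ j)).x₁ → j ≤ k → (S (σ i)).x₂ ≤ (S (σ k)).x₁) ∧
      ∀ i j, i < j → (S (σ i)).y₂ ≤ (S (σ j)).y₁ ∨
        ∃ l, (S (σ l)).x₂ ≤ (S (σ j)).x₁ ∧ ¬ (S (σ l)).x₂ ≤ (S (σ i)).x₁ := by
  let key : Fin n → ℕ ×ₗ ℤ := fun i => toLex ((leftOf S i).card, (S i).y₁)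
  let σ := Tuple.sort key
  have hmono : Monotone (key ∘ σ) := Tuple.monotone_sort key
  have hle : ∀ i j, i ≤ j → (leftOf S (σ i)).card < (leftOf S (σ j)).card ∨
      (leftOf S (σ i)).card = (leftOf S (σ j)).card ∧ (S (σ i)).y₁ ≤ (S (σ j)).y₁ :=
    fun i j hij => Prod.Lex.toLex_le_toLex.1 (hmono hij)
  have hcard : ∀ i j, i ≤ j → (leftOf S (σ i)).card ≤ (leftOf S (σ j)).card := fun i j hij =>
    (hle i j hij).elim (fun h => h.le) fun h => h.1.le
  refine ⟨σ, fun i j hij => ?_, fun i j k hij hjk => ?_, fun i j hij => ?_⟩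
  · by_contra hji
    exact absurd (card_leftOf_lt hij) (not_lt.2 (hcard j i (not_lt.1 hji)))
  · exact mem_leftOf.1 (leftOf_subset_of_card_le (hcard j k hjk) (mem_leftOf.2 hij))
  · rcases hle i j hij.le with h1 | ⟨h1, h2⟩
    · right
      have hns : ¬ leftOf S (σ j) ⊆ leftOf S (σ i) := fun hs =>
        absurd (Finset.card_le_card hs) (not_le.2 h1)
      obtain ⟨l, hl, hl'⟩ := Finset.not_subset.1 hns
      refine ⟨σ.symm l, ?_, ?_⟩
      · simpa using hl
      · simpa using hl'
    · left
      -- Equal cardinalities rule out horizontal separation, so the two are stacked, and the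
      -- tie-break on `y₁` tells which is lower.
      have h3 := h.disjoint _ _ (σ.injective.ne hij.ne)
      have h4 := (S (σ j)).hy
      have h5 := mt (card_leftOf_lt (S := S) (i := σ i) (j := σ j)) h1.not_lt
      have h6 := mt (card_leftOf_lt (S := S) (i := σ j) (j := σ i)) h1.not_gt
      omega

/-- Mutually visible rectangles in a strip of six rows give an admissible sequence of masks. -/
theorem exists_isAdmissible {n : ℕ} {S : Fin n → IntRect} (h : IsMutuallyVisible S) {Y : ℤ}
    (hY : ∀ i, Y ≤ (S i).y₁) (hY' : ∀ i, (S i).y₂ ≤ Y + 6) : ∃ m, IsAdmissible n m := by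
  obtain ⟨σ, hlt, hup, hstep⟩ := h.exists_order
  have hT := h.comp σ.injective
  let m : ℕ → ℕ := fun i => if hi : i < n then (S (σ ⟨i, hi⟩)).rowMask Y else 0
  have hm : ∀ i : Fin n, m i = (S (σ i)).rowMask Y := fun i => by simp [m]
  have hmeet : ∀ i j : Fin n, i < j →
      (m i &&& m j ≠ 0 ↔ (S (σ i)).x₂ ≤ (S (σ j)).x₁) := fun i j hij => by
    rw [hm, hm, IntRect.rowMask_land_ne_zero_iff (hY _) (hY _)]
    constructor
    · rintro ⟨t, hi, hj⟩
      exact (hT.separated_of_hasRow hij.ne hi hj).resolve_right fun h1 =>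
        absurd (hlt j i h1) hij.not_gt
    · intro h1
      obtain ⟨t, hi, hj, -⟩ := hT.rowSees h1
      exact ⟨t, hi, hj⟩
  refine ⟨m, fun i hi => ?_, fun i j k hij hjk hk hne => ?_, fun i j hij hj hne => ?_,
    fun j hj => ?_, fun f hf h0 => ?_⟩
  · rw [hm ⟨i, hi⟩]
    exact IntRect.rowMask_mem (hY _) (hY' _)
  · have h1 := (hmeet ⟨i, by omega⟩ ⟨j, by omega⟩ hij).1 hne
    exact (hmeet ⟨i, by omega⟩ ⟨k, hk⟩ (hij.trans hjk)).2 (hup _ _ _ h1 hjk.le)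
  · have h1 := (hmeet ⟨i, by omega⟩ ⟨j, hj⟩ hij).1 hne
    obtain ⟨t, hi, hj', ht⟩ := hT.rowSees h1
    have hYt : Y + ((t - Y).toNat : ℤ) = t := by
      have h2 := (hY (σ ⟨i, by omega⟩)).trans hi.1
      omega
    refine ⟨(t - Y).toNat, ?_, ?_, fun k hik hkj => ?_⟩
    · rw [hm ⟨i, by omega⟩, IntRect.testBit_rowMask (hY _), hYt]
      exact hi
    · rw [hm ⟨j, hj⟩, IntRect.testBit_rowMask (hY _), hYt]
      exact hj'
    · by_contra hk
      rw [Bool.not_eq_false, hm ⟨k, by omega⟩, IntRect.testBit_rowMask (hY _), hYt] at hk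
      have hik' : (⟨i, by omega⟩ : Fin n) < ⟨k, by omega⟩ := hik
      have hkj' : (⟨k, by omega⟩ : Fin n) < ⟨j, hj⟩ := hkj
      refine (ht _ hik'.ne' hkj'.ne hk).1 ⟨?_, ?_⟩
      · exact (hT.separated_of_hasRow hik'.ne hi hk).resolve_right fun h1 =>
          absurd (hlt _ _ h1) hik'.not_gt
      · exact (hT.separated_of_hasRow hkj'.ne hk hj').resolve_right fun h1 =>
          absurd (hlt _ _ h1) hkj'.not_gt
  · have hjj : (⟨j, by omega⟩ : Fin n) < ⟨j + 1, hj⟩ := Nat.lt_succ_self j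
    rcases hstep _ _ hjj with h1 | ⟨l, hl, hl'⟩
    · left
      rw [hm ⟨j, by omega⟩, hm ⟨j + 1, hj⟩]
      exact IntRect.rowMask_le_of_y₂_le (hY _) h1
    · right
      have hlj : (l : ℕ) < j + 1 := hlt _ _ hl
      refine ⟨l, by omega, (hmeet l ⟨j + 1, hj⟩ hlj).2 hl, fun k hlk hkj => ?_⟩
      -- If `l` met some `k ≤ j`, it would lie to the left of `k`, hence of `j`.
      by_contra hne
      exact hl' (hup _ _ _ ((hmeet l ⟨k, by omega⟩ hlk).1 hne) hkj)
  · have hdis : ∀ a b, a ≠ b → ∀ t, (S (σ ⟨f a, hf a⟩)).HasRow t →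
        ¬ (S (σ ⟨f b, hf b⟩)).HasRow t := fun a b hab t h1 h2 => by
      have h3 := h0 a b hab
      rw [hm ⟨f a, hf a⟩, hm ⟨f b, hf b⟩] at h3
      exact (IntRect.rowMask_land_ne_zero_iff (hY _) (hY _)).2 ⟨t, h1, h2⟩ h3
    have hinj : Function.Injective fun a => σ ⟨f a, hf a⟩ := fun a b hab => by
      by_contra hne
      have h1 : (S (σ ⟨f a, hf a⟩)).HasRow (S (σ ⟨f a, hf a⟩)).y₁ := ⟨le_rfl, (S _).hy⟩
      have h2 := hdis a b hne _ h1
      simp only at hab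
      rw [← hab] at h2
      exact h2 h1
    refine (h.comp hinj).not_stacked fun a b hab => ?_
    -- The higher of the two lower sides starts a common row unless the rectangles are separated
    -- vertically.
    have h1 := hdis a b hab (max (S (σ ⟨f a, hf a⟩)).y₁ (S (σ ⟨f b, hf b⟩)).y₁)
    have h2 := (S (σ ⟨f a, hf a⟩)).hy
    have h3 := (S (σ ⟨f b, hf b⟩)).hy
    simp only [IntRect.HasRow] at h1
    omega

end IsMutuallyVisible

theorem seven_le_of_mem_representationHeights {h : ℤ}
    (hh : h ∈ representationHeights (SimpleGraph.completeGraph (Fin 7))) : 7 ≤ h := by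
  obtain ⟨S, R, hS, hR, -, rfl⟩ := hh
  by_contra hlt
  have hbox := fun i => IntRect.toSet_subset_iff.1 (hR.1 i)
  obtain ⟨m, hm⟩ := hS.isMutuallyVisible.exists_isAdmissible (Y := R.y₁)
    (fun i => (hbox i).2.1) fun i => by
      have h1 := (hbox i).2.2
      rw [IntRect.height] at hlt
      omega
  exact not_isAdmissible_seven m hm

theorem mainTheorem2 : HasHeight (SimpleGraph.completeGraph (Fin 7)) 7 :=
  ⟨seven_mem_representationHeights, fun _ h => seven_le_of_mem_representationHeights h⟩
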